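/- For every positive integer $d$, let $X_d$ and $Y_d$ be Hilbert spaces over $\mathbb K\in\{\mathbb R,\mathbb C\}$ and let $T_d:X_d\to Y_d$ be a compact linear operator with $\|T_d\|=1$. Let $T_d^d:X_d^d\to Y_d^d$ be its $d$th tensor power, that is, the unique bounded operator between the $d$-fold Hilbert space tensor powers $X_d^d$ and $Y_d^d$ (the completions of the algebraic tensor powers with respect to $\langle f_1\otimes\cdots\otimes f_d,\,g_1\otimes\cdots\otimes g_d\rangle=\prod_{j=1}^d\langle f_j,g_j\rangle$) such that $T_d^d(f_1\otimes\cdots\otimes f_d)=T_df_1\otimes\cdots\otimes T_df_d$. For a bounded operator $T$ let $a_n(T)=\inf\{\|T-A\| : \operatorname{rank}A<n\}$, $n\ge 1$, be its approximation numbers. Say that a sequence $(u_n)_{n\ge1}$ of nonnegative numbers decays polynomially in $n$ if there are $C,s>0$ with $u_n\le C\,n^{-s}$ for all $n\ge1$. Let $e(n,d)=\inf_{A}\sup_{\|f\|\le 1}\|T_d^df-Af\|$, where the infimum is over all algorithms $A$, from the closed unit ball of $X_d^d$ to $Y_d^d$, that use at most $n$ continuous linear functionals on $X_d^d$ (i.e.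 $Af=\varphi(y_1,\dots,y_n)$ with an arbitrary map $\varphi$ and $y_k=L_k(f)$, where the continuous linear functional $L_k$ may depend on $y_1,\dots,y_{k-1}$). Let $n(\varepsilon,d)=\min\{n\in\mathbb N_0 : e(n,d)<\varepsilon\}$. The problem $\{T_d^d\}$ is called polynomially tractable if there are nonnegative numbers $C,p,q$ such that $n(\varepsilon,d)\le C\,\varepsilon^{-q}\,d^{\,p}$ for all positive integers $d$ and all $\varepsilon>0$, and strongly polynomially tractable if this holds with $p=0$. Assume that, for every $n\ge1$, $a_n(T_d)$ is nonincreasing in $d$, and that $a_n(T_1)$ decays polynomially in $n$. Then the following are equivalent: 1. the problem $\{T_d^d\}$ is strongly polynomially tractable; 2. the problem $\{T_d^d\}$ is polynomially tractable; 3. $a_2(T_d)$ decays polynomially in $d$. -/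

import Mathlib

open scoped ComplexOrder ENNReal

noncomputable section

namespace TensorTractability

universe u v w

/-! ### The Hilbert space tensor power

The algebraic tensor power with the inner product determined by
`⟪f₁ ⊗ ⋯ ⊗ f_d, g₁ ⊗ ⋯ ⊗ g_d⟫ = ∏ i, ⟪f_i, g_i⟫`, and then its completion. -/

section Algebraic

variable (𝕜 : Type u) [RCLike 𝕜] (d : ℕ) (X : Type v)
  [NormedAddCommGroup X] [InnerProductSpace 𝕜 X]

/-- The algebraic `d`th tensor power of `X`. (A type of its own, since Mathlib puts another
norm, the injective one, on `PiTensorProduct`.) -/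
def AlgTensorPower : Type (max u v) := PiTensorProduct 𝕜 fun _ : Fin d => X

instance : AddCommGroup (AlgTensorPower 𝕜 d X) :=
  inferInstanceAs (AddCommGroup (PiTensorProduct 𝕜 fun _ : Fin d => X))

instance : Module 𝕜 (AlgTensorPower 𝕜 d X) :=
  inferInstanceAs (Module 𝕜 (PiTensorProduct 𝕜 fun _ : Fin d => X))

end Algebraic

section Algebraic

variable {𝕜 : Type u} [RCLike 𝕜] {d : ℕ} {X : Type v}
  [NormedAddCommGroup X] [InnerProductSpace 𝕜 X] {Y : Type w}
  [NormedAddCommGroup Y] [InnerProductSpace 𝕜 Y]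

/-- The pure tensor `f₁ ⊗ ⋯ ⊗ f_d` in the algebraic tensor power. -/
def algTprod (f : Fin d → X) : AlgTensorPower 𝕜 d X := PiTensorProduct.tprod 𝕜 f

/-- The linear functional `g₁ ⊗ ⋯ ⊗ g_d ↦ ∏ i, ⟪f_i, g_i⟫`. -/
def innerForm (f : Fin d → X) : AlgTensorPower 𝕜 d X →ₗ[𝕜] 𝕜 :=
  PiTensorProduct.lift
    ((MultilinearMap.mkPiAlgebra 𝕜 (Fin d) 𝕜).compLinearMap
      fun i => (innerSL 𝕜 (f i)).toLinearMap)

theorem innerForm_algTprod (f g : Fin d → X) :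
    innerForm (𝕜 := 𝕜) f (algTprod g) = ∏ i, inner 𝕜 (f i) (g i) := by
  unfold innerForm algTprod
  erw [PiTensorProduct.lift.tprod]
  simp

theorem alg_induction {p : AlgTensorPower 𝕜 d X → Prop} (x : AlgTensorPower 𝕜 d X)
    (h1 : ∀ (r : 𝕜) (f : Fin d → X), p (r • algTprod f))
    (h2 : ∀ x y, p x → p y → p (x + y)) : p x :=
  PiTensorProduct.induction_on (R := 𝕜) (s := fun _ : Fin d => X) (motive := p) x h1 h2

theorem innerForm_algTprod_symm (f g : Fin d → X) :
    (starRingEnd 𝕜) (innerForm (𝕜 := 𝕜) f (algTprod g)) = innerForm g (algTprod f) := by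
  simp [innerForm_algTprod, map_prod]

theorem algTprod_update_add [DecidableEq (Fin d)] (f : Fin d → X) (i : Fin d) (a b : X) :
    algTprod (𝕜 := 𝕜) (Function.update f i (a + b)) =
      algTprod (Function.update f i a) + algTprod (Function.update f i b) :=
  MultilinearMap.map_update_add (PiTensorProduct.tprod 𝕜 (s := fun _ : Fin d => X)) f i a b

theorem algTprod_update_smul [DecidableEq (Fin d)] (f : Fin d → X) (i : Fin d) (c : 𝕜) (a : X) :
    algTprod (𝕜 := 𝕜) (Function.update f i (c • a)) = c • algTprod (Function.update f i a) :=
  MultilinearMap.map_update_smul (PiTensorProduct.tprod 𝕜 (s := fun _ : Fin d => X)) f i c a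

/-- `f ↦ (x ↦ ⟪x, f₁ ⊗ ⋯ ⊗ f_d⟫)`, linear in each `f_i` and conjugate linear in `x`. -/
def innerMultilinear :
    MultilinearMap 𝕜 (fun _ : Fin d => X) (AlgTensorPower 𝕜 d X →ₗ⋆[𝕜] 𝕜) where
  toFun f :=
    { toFun := fun x => (starRingEnd 𝕜) (innerForm f x)
      map_add' := fun x y => by simp
      map_smul' := fun c x => by simp }
  map_update_add' f i a b := by
    ext x
    change (starRingEnd 𝕜) _ = (starRingEnd 𝕜) _ + (starRingEnd 𝕜) _
    induction x using alg_induction with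
    | h1 r g =>
      simp only [map_smul, smul_eq_mul, map_mul, innerForm_algTprod_symm, algTprod_update_add,
        map_add, mul_add]
    | h2 x y hx hy => simp only [map_add, hx, hy]; ring
  map_update_smul' f i c a := by
    ext x
    change (starRingEnd 𝕜) _ = c • (starRingEnd 𝕜) _
    induction x using alg_induction with
    | h1 r g =>
      simp only [map_smul, smul_eq_mul, map_mul, innerForm_algTprod_symm, algTprod_update_smul]
      ring
    | h2 x y hx hy => simp only [map_add, hx, hy, smul_add]

/-- `y ↦ (x ↦ ⟪x, y⟫)`, linear in `y` and conjugate linear in `x`. -/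
def innerLift : AlgTensorPower 𝕜 d X →ₗ[𝕜] (AlgTensorPower 𝕜 d X →ₗ⋆[𝕜] 𝕜) :=
  PiTensorProduct.lift innerMultilinear

/-- The inner product `⟪x, y⟫` on the algebraic tensor power. -/
def algInner (x y : AlgTensorPower 𝕜 d X) : 𝕜 := innerLift y x

theorem algInner_tprod_right (x : AlgTensorPower 𝕜 d X) (f : Fin d → X) :
    algInner x (algTprod f) = (starRingEnd 𝕜) (innerForm f x) := by
  unfold algInner innerLift algTprod
  erw [PiTensorProduct.lift.tprod]
  rfl

theorem algInner_tprod (f g : Fin d → X) :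
    algInner (𝕜 := 𝕜) (algTprod f) (algTprod g) = ∏ i, inner 𝕜 (f i) (g i) := by
  rw [algInner_tprod_right, innerForm_algTprod_symm, innerForm_algTprod]

theorem algInner_add_left (x y z : AlgTensorPower 𝕜 d X) :
    algInner (x + y) z = algInner x z + algInner y z := by
  simp only [algInner, map_add]

theorem algInner_add_right (x y z : AlgTensorPower 𝕜 d X) :
    algInner x (y + z) = algInner x y + algInner x z := by
  simp only [algInner, map_add, LinearMap.add_apply]

theorem algInner_smul_left (c : 𝕜) (x y : AlgTensorPower 𝕜 d X) :
    algInner (c • x) y = (starRingEnd 𝕜) c * algInner x y := by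
  simp only [algInner, LinearMap.map_smulₛₗ, smul_eq_mul]

theorem algInner_smul_right (c : 𝕜) (x y : AlgTensorPower 𝕜 d X) :
    algInner x (c • y) = c * algInner x y := by
  simp only [algInner, map_smul, LinearMap.smul_apply, smul_eq_mul]

theorem algInner_symm (x y : AlgTensorPower 𝕜 d X) :
    (starRingEnd 𝕜) (algInner y x) = algInner x y := by
  induction x using alg_induction with
  | h2 x x' hx hx' => simp only [algInner_add_left, algInner_add_right, map_add, hx, hx']
  | h1 r f =>
    induction y using alg_induction with
    | h2 y y' hy hy' => simp only [algInner_add_left, algInner_add_right, map_add, hy, hy']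
    | h1 s g =>
      simp only [algInner_smul_left, algInner_smul_right, algInner_tprod, map_mul, map_prod,
        inner_conj_symm, RingHomCompTriple.comp_apply, RingHom.id_apply]
      ring

theorem exists_sum_tprod (x : AlgTensorPower 𝕜 d X) :
    ∃ (n : ℕ) (c : Fin n → 𝕜) (f : Fin n → Fin d → X), x = ∑ k, c k • algTprod (f k) := by
  have hx : x ∈ Submodule.span 𝕜 (Set.range (algTprod (𝕜 := 𝕜) (d := d) (X := X))) := by
    induction x using alg_induction with
    | h1 r f => exact Submodule.smul_mem _ _ (Submodule.subset_span ⟨f, rfl⟩)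
    | h2 x y hx hy => exact Submodule.add_mem _ hx hy
  obtain ⟨n, c, g, h⟩ := Submodule.mem_span_set'.1 hx
  choose f hf using fun k => (g k).2
  exact ⟨n, c, f, by rw [← h]; exact Finset.sum_congr rfl fun k _ => by rw [hf]⟩

theorem algInner_sum_right {n : ℕ} (x : AlgTensorPower 𝕜 d X)
    (y : Fin n → AlgTensorPower 𝕜 d X) :
    algInner x (∑ k, y k) = ∑ k, algInner x (y k) := by
  simp only [algInner, map_sum, LinearMap.sum_apply]

theorem algInner_sum_left {n : ℕ} (x : AlgTensorPower 𝕜 d X)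
    (y : Fin n → AlgTensorPower 𝕜 d X) :
    algInner (∑ k, y k) x = ∑ k, algInner (y k) x := by
  simp only [algInner, map_sum]

theorem algInner_sum_sum {n : ℕ} (c : Fin n → 𝕜) (f : Fin n → Fin d → X) :
    algInner (∑ k, c k • algTprod (f k)) (∑ k, c k • algTprod (f k)) =
      star c ⬝ᵥ
        (Matrix.of fun j k => ∏ i, inner 𝕜 (f j i) (f k i) : Matrix (Fin n) (Fin n) 𝕜).mulVec c := by
  rw [algInner_sum_left]
  simp only [algInner_sum_right, algInner_smul_left, algInner_smul_right, algInner_tprod,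
    dotProduct, Matrix.mulVec, Matrix.of_apply, Pi.star_apply, RCLike.star_def]
  refine Finset.sum_congr rfl fun j _ => ?_
  rw [Finset.mul_sum]
  exact Finset.sum_congr rfl fun k _ => by ring

/-- Entrywise products of matrices `0 ≤ B i ≤ A i` satisfy `0 ≤ ∏ B i ≤ ∏ A i`. -/
theorem posSemidef_prod_sub_prod {n : ℕ} (s : Finset (Fin d))
    (A B : Fin d → Matrix (Fin n) (Fin n) 𝕜) (hB : ∀ i, (B i).PosSemidef)
    (hAB : ∀ i, (A i - B i).PosSemidef) :
    (Matrix.of fun j k => ∏ i ∈ s, B i j k : Matrix (Fin n) (Fin n) 𝕜).PosSemidef ∧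
      (Matrix.of fun j k => ∏ i ∈ s, A i j k - ∏ i ∈ s, B i j k :
        Matrix (Fin n) (Fin n) 𝕜).PosSemidef := by
  classical
  induction s using Finset.induction_on with
  | empty =>
    refine ⟨?_, ?_⟩
    · have := Matrix.posSemidef_vecMulVec_self_star (fun _ : Fin n => (1 : 𝕜))
      convert this using 1
      ext j k
      simp [Matrix.vecMulVec]
    · convert Matrix.PosSemidef.zero (n := Fin n) (R := 𝕜) using 1
      ext j k
      simp
  | insert a s ha ih =>
    obtain ⟨ih1, ih2⟩ := ih
    refine ⟨?_, ?_⟩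
    · convert (hB a).hadamard ih1 using 1
      ext j k
      simp [Finset.prod_insert ha]
    · convert ((hAB a).hadamard (ih1.add ih2)).add ((hB a).hadamard ih2) using 1
      ext j k
      simp [Finset.prod_insert ha]
      ring

theorem algInner_self_nonneg (x : AlgTensorPower 𝕜 d X) : 0 ≤ RCLike.re (algInner x x) := by
  obtain ⟨n, c, f, rfl⟩ := exists_sum_tprod x
  rw [algInner_sum_sum]
  have h := (posSemidef_prod_sub_prod (𝕜 := 𝕜) (n := n) Finset.univ
    (fun i => Matrix.gram 𝕜 fun k => f k i) (fun i => Matrix.gram 𝕜 fun k => f k i)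
    (fun i => Matrix.posSemidef_gram 𝕜 _)
    (fun i => by rw [sub_self]; exact Matrix.PosSemidef.zero)).1
  exact (RCLike.nonneg_iff.1 (h.dotProduct_mulVec_nonneg c)).1

/-- The inner product structure on the algebraic tensor power. -/
@[reducible] def algCore : PreInnerProductSpace.Core 𝕜 (AlgTensorPower 𝕜 d X) where
  inner := algInner
  conj_inner_symm := algInner_symm
  re_inner_nonneg := algInner_self_nonneg
  add_left := algInner_add_left
  smul_left x y r := algInner_smul_left r x y

instance : SeminormedAddCommGroup (AlgTensorPower 𝕜 d X) :=
  InnerProductSpace.Core.toSeminormedAddCommGroup (c := algCore (𝕜 := 𝕜) (d := d) (X := X))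

instance : InnerProductSpace 𝕜 (AlgTensorPower 𝕜 d X) := InnerProductSpace.ofCore algCore

theorem inner_algTprod (f g : Fin d → X) :
    inner 𝕜 (algTprod f : AlgTensorPower 𝕜 d X) (algTprod g) = ∏ i, inner 𝕜 (f i) (g i) :=
  algInner_tprod f g

/-- The algebraic tensor power of a linear map: `f₁ ⊗ ⋯ ⊗ f_d ↦ T f₁ ⊗ ⋯ ⊗ T f_d`. -/
def algMap (d : ℕ) (T : X →L[𝕜] Y) : AlgTensorPower 𝕜 d X →ₗ[𝕜] AlgTensorPower 𝕜 d Y :=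
  PiTensorProduct.map fun _ : Fin d => T.toLinearMap

theorem algMap_algTprod (T : X →L[𝕜] Y) (f : Fin d → X) :
    algMap d T (algTprod f) = algTprod fun i => T (f i) :=
  PiTensorProduct.map_tprod (fun _ : Fin d => T.toLinearMap) f

theorem norm_algMap_le (T : X →L[𝕜] Y) (x : AlgTensorPower 𝕜 d X) :
    ‖algMap d T x‖ ≤ ‖T‖ ^ d * ‖x‖ := by
  refine le_of_sq_le_sq ?_ (by positivity)
  obtain ⟨n, c, f, rfl⟩ := exists_sum_tprod x
  have h := (posSemidef_prod_sub_prod (𝕜 := 𝕜) (n := n) Finset.univ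
    (fun i => ‖T‖ ^ 2 • Matrix.gram 𝕜 fun k => f k i)
    (fun i => Matrix.gram 𝕜 fun k => T (f k i))
    (fun i => Matrix.posSemidef_gram 𝕜 _)
    (fun i => Matrix.posSemidef_opNorm_smul_gram_sub_gram (fun k => f k i) T)).2
  have h0 := (RCLike.nonneg_iff.1 (h.dotProduct_mulVec_nonneg c)).1
  have hM : (Matrix.of fun j k => ∏ i, (‖T‖ ^ 2 • Matrix.gram 𝕜 fun k => f k i) j k -
      ∏ i, (Matrix.gram 𝕜 fun k => T (f k i)) j k : Matrix (Fin n) (Fin n) 𝕜) =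
      (((‖T‖ ^ d) ^ 2 : ℝ) : 𝕜) • (Matrix.of fun j k => ∏ i, inner 𝕜 (f j i) (f k i)) -
        (Matrix.of fun j k => ∏ i, inner 𝕜 (T (f j i)) (T (f k i))) := by
    ext j k
    simp [Finset.prod_mul_distrib, RCLike.real_smul_eq_coe_mul, ← pow_mul, mul_comm]
  rw [hM, Matrix.sub_mulVec, Matrix.smul_mulVec, dotProduct_sub, dotProduct_smul,
    ← algInner_sum_sum, ← algInner_sum_sum c fun k i => T (f k i), smul_eq_mul, map_sub,
    RCLike.re_ofReal_mul, sub_nonneg] at h0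
  rw [mul_pow, ← inner_self_eq_norm_sq (𝕜 := 𝕜), ← inner_self_eq_norm_sq (𝕜 := 𝕜)]
  simp only [map_sum, map_smul, algMap_algTprod]
  exact h0

/-- The algebraic tensor power of a bounded operator, as a bounded operator. -/
def algMapL (d : ℕ) (T : X →L[𝕜] Y) : AlgTensorPower 𝕜 d X →L[𝕜] AlgTensorPower 𝕜 d Y :=
  (algMap d T).mkContinuous (‖T‖ ^ d) (norm_algMap_le T)

end Algebraic

section Hilbert

/-- The `d`th tensor power `X^d` of the Hilbert space `X`: the completion of the algebraic
tensor power. -/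
abbrev HilbertTensorPower (𝕜 : Type u) [RCLike 𝕜] (d : ℕ) (X : Type v) [NormedAddCommGroup X]
    [InnerProductSpace 𝕜 X] : Type (max u v) :=
  UniformSpace.Completion (AlgTensorPower 𝕜 d X)

variable {𝕜 : Type u} [RCLike 𝕜] {d : ℕ} {X : Type v}
  [NormedAddCommGroup X] [InnerProductSpace 𝕜 X] {Y : Type w}
  [NormedAddCommGroup Y] [InnerProductSpace 𝕜 Y]

/-- The pure tensor `f₁ ⊗ ⋯ ⊗ f_d` in `X^d`. -/
def pureTensor (f : Fin d → X) : HilbertTensorPower 𝕜 d X :=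
  ((algTprod f : AlgTensorPower 𝕜 d X) : UniformSpace.Completion (AlgTensorPower 𝕜 d X))

/-- The `d`th tensor power `T^d : X^d → Y^d` of a bounded operator `T : X → Y`. -/
def tensorPowerMap (d : ℕ) (T : X →L[𝕜] Y) : HilbertTensorPower 𝕜 d X →L[𝕜] HilbertTensorPower 𝕜 d Y :=
  (algMapL d T).completion

theorem inner_pureTensor (f g : Fin d → X) :
    inner 𝕜 (pureTensor f : HilbertTensorPower 𝕜 d X) (pureTensor g) = ∏ i, inner 𝕜 (f i) (g i) := by
  unfold pureTensor
  rw [UniformSpace.Completion.inner_coe, inner_algTprod]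

theorem tensorPowerMap_pureTensor (T : X →L[𝕜] Y) (f : Fin d → X) :
    tensorPowerMap d T (pureTensor f) = pureTensor fun i => T (f i) := by
  unfold pureTensor tensorPowerMap
  rw [ContinuousLinearMap.completion_apply_coe]
  exact congrArg _ (algMap_algTprod T f)

/-- The linear span of the pure tensors is dense in `X^d`. -/
theorem dense_span_pureTensor :
    Dense (Submodule.span 𝕜 (Set.range (pureTensor (𝕜 := 𝕜) (d := d) (X := X))) :
      Set (HilbertTensorPower 𝕜 d X)) := by
  refine UniformSpace.Completion.denseRange_coe.mono ?_
  rintro _ ⟨x, rfl⟩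
  obtain ⟨n, c, f, rfl⟩ := exists_sum_tprod x
  have h : ((∑ k, c k • algTprod (f k) : AlgTensorPower 𝕜 d X) : HilbertTensorPower 𝕜 d X) =
      ∑ k, c k • pureTensor (f k) := by
    have := map_sum (UniformSpace.Completion.toComplL (𝕜 := 𝕜) (E := AlgTensorPower 𝕜 d X))
      (fun k => c k • algTprod (f k)) Finset.univ
    simp only [map_smul] at this
    exact this
  rw [h]
  exact Submodule.sum_mem _ fun k _ => Submodule.smul_mem _ _ (Submodule.subset_span ⟨_, rfl⟩)

end Hilbert

/-! ### Approximation numbers and polynomial decay -/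

/-- The `n`th approximation number `a_n(T) = inf {‖T - A‖ : rank A < n}` (for `n ≥ 1`). -/
def approxNumber {𝕜 : Type u} [RCLike 𝕜] {X : Type v} [NormedAddCommGroup X]
    [InnerProductSpace 𝕜 X] {Y : Type w} [NormedAddCommGroup Y] [InnerProductSpace 𝕜 Y]
    (n : ℕ) (T : X →L[𝕜] Y) : ℝ :=
  sInf {r : ℝ | ∃ A : X →L[𝕜] Y, A.toLinearMap.rank < n ∧ r = ‖T - A‖}

/-- A sequence of nonnegative numbers decays polynomially if it is bounded by `C n ^ (-s)` for
some `C, s > 0`. -/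
def DecaysPolynomially (a : ℕ+ → ℝ) : Prop :=
  ∃ C s : ℝ, 0 < C ∧ 0 < s ∧ ∀ n : ℕ+, a n ≤ C * (n : ℝ) ^ (-s)

/-! ### Algorithms using linear information, and tractability -/

section Tractability

/-- An algorithm based on continuous linear functionals on `X`, with values in `Y`. If the values
`y₁, …, y_k` have been observed, the next functional is `functional [y₁, …, y_k]` and the output,
in case that the algorithm stops here, is `output [y₁, …, y_k]`, where `output` is arbitrary. -/
structure Algorithm (𝕜 : Type u) [RCLike 𝕜] (X : Type v) [NormedAddCommGroup X]
    [NormedSpace 𝕜 X] (Y : Type w) where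
  functional : List 𝕜 → X →L[𝕜] 𝕜
  output : List 𝕜 → Y

variable {𝕜 : Type u} [RCLike 𝕜] {X : Type v} [NormedAddCommGroup X] [NormedSpace 𝕜 X]
  {Y : Type w}

/-- The values of the first `n` functionals at the input `f`. -/
def Algorithm.info (A : Algorithm 𝕜 X Y) (f : X) : ℕ → List 𝕜
  | 0 => []
  | n + 1 => A.info f n ++ [A.functional (A.info f n) f]

/-- The output at the input `f` after the evaluation of `n` functionals. -/
def Algorithm.run (A : Algorithm 𝕜 X Y) (n : ℕ) (f : X) : Y := A.output (A.info f n)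

variable [NormedAddCommGroup Y]

variable (𝕜) in
/-- The `n`th minimal worst case error `e(n)` for the approximation of `T : F → Y`, `F ⊆ X`, by
algorithms that use at most `n` continuous linear functionals on `X`. -/
def minimalError (F : Set X) (T : X → Y) (n : ℕ) : ℝ≥0∞ :=
  ⨅ A : Algorithm 𝕜 X Y, ⨆ f ∈ F, ‖T f - A.run n f‖ₑ

variable (𝕜) in
/-- The information complexity `n(ε) = min {n | e(n) < ε}` (`⊤` if there is no such `n`). -/
def informationComplexity (F : Set X) (T : X → Y) (ε : ℝ) : ℕ∞ :=
  ⨅ (n : ℕ) (_ : minimalError 𝕜 F T n < ENNReal.ofReal ε), (n : ℕ∞)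

end Tractability

section Problem

variable {𝕜 : Type u} [RCLike 𝕜]
  {X : ℕ+ → Type v} [∀ d, NormedAddCommGroup (X d)] [∀ d, InnerProductSpace 𝕜 (X d)]
  {Y : ℕ+ → Type w} [∀ d, NormedAddCommGroup (Y d)] [∀ d, InnerProductSpace 𝕜 (Y d)]

/-- `n(ε, d) ≤ C ε ^ (-q) d ^ p` for all `d` and all `ε > 0`, where `n(ε, d)` is the information
complexity of approximating `S d` on the unit ball. -/
def ComplexityBound (S : ∀ d, X d →L[𝕜] Y d) (C p q : ℝ) : Prop :=
  ∀ (d : ℕ+) (ε : ℝ), 0 < ε →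
    (informationComplexity 𝕜 (Metric.closedBall (0 : X d) 1) (S d) ε : ℝ≥0∞) ≤
      ENNReal.ofReal (C * ε ^ (-q) * (d : ℝ) ^ p)

/-- The problem `{S d}` is polynomially tractable. -/
def PolynomiallyTractable (S : ∀ d, X d →L[𝕜] Y d) : Prop :=
  ∃ C p q : ℝ, 0 ≤ C ∧ 0 ≤ p ∧ 0 ≤ q ∧ ComplexityBound S C p q

/-- The problem `{S d}` is strongly polynomially tractable. -/
def StronglyPolynomiallyTractable (S : ∀ d, X d →L[𝕜] Y d) : Prop :=
  ∃ C q : ℝ, 0 ≤ C ∧ 0 ≤ q ∧ ComplexityBound S C 0 q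

end Problem

end TensorTractability

end

open TensorTractability

/-! Each compact `T d` has a Hilbert basis `b` of eigenvectors of its `T*T`, so the images `T d (b
i)` are pairwise orthogonal. Pure tensors of these vectors form a Hilbert basis of the tensor power
whose images are again orthogonal, with norms equal to products of singular values. For such an
operator the complexity is governed by counting basis vectors with large image: truncating the
expansion bounds it above (`OrthogonalImages.minimalError_le`), and a fooling pair `f`, `-f` with
vanishing information bounds it below, even for adaptive algorithms
(`OrthogonalImages.le_minimalError`).

Decay of `a_2` implies strong tractability: for large `q` the two decay hypotheses give `∑
a_n(T_d)^q ≤ 1 + B/d` (`sum_rpow_le_of_decay`), so the power sum of the tensor singular values is at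
most `(1 + B/d)^d ≤ exp B`, uniformly in `d`. Markov's inequality turns this into a count
independent of `d`.

Polynomial tractability implies decay of `a_2`: the norm 1 is attained at some basis vector, and
another one has image norm `σ > a_2 / 2`. Placing the latter in `k` of the `d` slots gives `d.choose
k` basis tensors with image norm `σ^k`, hence `d.choose k ≤ C σ^(-kq) d^p`. As the left side grows
like `d^k`, taking `k ≥ p + 1` forces `σ^(kq)` to be at most a constant times `1/d`
(`le_of_choose_le`). -/

noncomputable section

namespace TensorTractability

universe u v w

/-! ### Singular bases and approximation numbers -/

section SingularBasis

variable {𝕜 : Type u} [RCLike 𝕜] {X : Type v} [NormedAddCommGroup X] [InnerProductSpace 𝕜 X]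
  {Y : Type w} [NormedAddCommGroup Y] [InnerProductSpace 𝕜 Y]

/-- Pythagoras' theorem for finitely many pairwise orthogonal vectors. -/
theorem norm_sum_sq_of_pairwise_inner_eq_zero {ι : Type*} (w : ι → Y)
    (hw : Pairwise fun i j => inner 𝕜 (w i) (w j) = 0) (F : Finset ι) :
    ‖∑ i ∈ F, w i‖ ^ 2 = ∑ i ∈ F, ‖w i‖ ^ 2 := by
  classical
  induction F using Finset.induction_on with
  | empty => simp
  | insert a s ha ih =>
    have h0 : inner 𝕜 (w a) (∑ i ∈ s, w i) = 0 := by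
      rw [inner_sum]
      exact Finset.sum_eq_zero fun i hi => hw (by rintro rfl; exact ha hi)
    have h := norm_add_sq_eq_norm_sq_add_norm_sq_of_inner_eq_zero _ _ h0
    rw [Finset.sum_insert ha, Finset.sum_insert ha, ← ih]
    simpa only [sq] using h

/-- The images of the vectors `b i` under `S` are pairwise orthogonal. -/
def OrthogonalImages {ι : Type*} (S : X →L[𝕜] Y) (b : ι → X) : Prop :=
  Pairwise fun i j => inner 𝕜 (S (b i)) (S (b j)) = 0

theorem OrthogonalImages.norm_map_sum_sq {ι : Type*} {S : X →L[𝕜] Y} {b : ι → X}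
    (hb : OrthogonalImages S b) (F : Finset ι) (c : ι → 𝕜) :
    ‖S (∑ i ∈ F, c i • b i)‖ ^ 2 = ∑ i ∈ F, ‖c i‖ ^ 2 * ‖S (b i)‖ ^ 2 := by
  have h := norm_sum_sq_of_pairwise_inner_eq_zero (𝕜 := 𝕜) (fun i => c i • S (b i))
    (fun i j hij => by simp [inner_smul_left, inner_smul_right, hb hij]) F
  simpa [map_sum, norm_smul, mul_pow] using h

theorem Orthonormal.norm_sum_smul_sq {ι : Type*} {b : ι → X} (hb : Orthonormal 𝕜 b)
    (F : Finset ι) (c : ι → 𝕜) : ‖∑ i ∈ F, c i • b i‖ ^ 2 = ∑ i ∈ F, ‖c i‖ ^ 2 := by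
  have h := OrthogonalImages.norm_map_sum_sq (S := ContinuousLinearMap.id 𝕜 X) (b := b)
    (fun i j hij => hb.2 hij) F c
  simpa [hb.1] using h

/-- Bounding below an operator with orthogonal images on the span of finitely many vectors. -/
theorem OrthogonalImages.le_norm_map_sum {ι : Type*} {S : X →L[𝕜] Y} {b : ι → X}
    (hb : OrthogonalImages S b) (ho : Orthonormal 𝕜 b) {F : Finset ι} {s : ℝ} (hs : 0 ≤ s)
    (hF : ∀ i ∈ F, s ≤ ‖S (b i)‖) (c : ι → 𝕜) :
    s * ‖∑ i ∈ F, c i • b i‖ ≤ ‖S (∑ i ∈ F, c i • b i)‖ := by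
  refine le_of_sq_le_sq ?_ (norm_nonneg _)
  rw [mul_pow, hb.norm_map_sum_sq, Orthonormal.norm_sum_smul_sq ho, Finset.mul_sum]
  refine Finset.sum_le_sum fun i hi => ?_
  rw [mul_comm]
  have := hF i hi
  gcongr

/-- Bounding the error of the truncated expansion in a basis with orthogonal images. -/
theorem OrthogonalImages.norm_map_sub_le {ι : Type*} {S : X →L[𝕜] Y} {b : HilbertBasis ι 𝕜 X}
    (hb : OrthogonalImages S b) {J : Finset ι} {s : ℝ} (hs : 0 ≤ s)
    (hJ : ∀ i ∉ J, ‖S (b i)‖ ≤ s) (f : X) :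
    ‖S f - ∑ i ∈ J, (inner 𝕜 (b i) f : 𝕜) • S (b i)‖ ≤ s * ‖f‖ := by
  classical
  have h1 : HasSum (fun i => (inner 𝕜 (b i) f : 𝕜) • S (b i)) (S f) := by
    have := (b.hasSum_repr f).mapL S
    simpa only [map_smul, b.repr_apply_apply] using this
  rw [HasSum, SummationFilter.unconditional_filter] at h1
  -- It suffices to bound partial sums over `F ⊇ J`: the difference is a sum over `F \ J`, where
  -- Pythagoras and then Bessel's inequality apply.
  refine le_of_tendsto (h1.sub_const (∑ i ∈ J, (inner 𝕜 (b i) f : 𝕜) • S (b i))).norm ?_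
  filter_upwards [Filter.eventually_ge_atTop J] with F hF
  have h2 := hb.norm_map_sum_sq (F \ J) fun i => (inner 𝕜 (b i) f : 𝕜)
  rw [map_sum, ← Finset.sum_sdiff hF, add_sub_cancel_right] at *
  simp only [map_smul] at h2
  refine le_of_sq_le_sq ?_ (by positivity)
  rw [h2, mul_pow]
  calc ∑ i ∈ F \ J, ‖(inner 𝕜 (b i) f : 𝕜)‖ ^ 2 * ‖S (b i)‖ ^ 2
      ≤ ∑ i ∈ F \ J, s ^ 2 * ‖(inner 𝕜 (b i) f : 𝕜)‖ ^ 2 := by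
        refine Finset.sum_le_sum fun i hi => ?_
        rw [mul_comm]
        have := hJ i (Finset.mem_sdiff.1 hi).2
        gcongr
    _ ≤ s ^ 2 * ‖f‖ ^ 2 := by
        rw [← Finset.mul_sum]
        gcongr
        exact b.orthonormal.sum_inner_products_le f

/-- Compact operators have a singular value decomposition. -/
theorem exists_hilbertBasis_orthogonalImages [CompleteSpace X] [CompleteSpace Y] {T : X →L[𝕜] Y}
    (hT : IsCompactOperator T) :
    ∃ (ι : Type (max u v)) (b : HilbertBasis ι 𝕜 X), OrthogonalImages T b := by
  set A : X →L[𝕜] X := (ContinuousLinearMap.adjoint T).comp T with hA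
  have hAc : IsCompactOperator A := hT.clm_comp (ContinuousLinearMap.adjoint T)
  have hAs : (A : X →ₗ[𝕜] X).IsSymmetric := by
    intro x y
    simp [hA, ContinuousLinearMap.adjoint_inner_left, ContinuousLinearMap.adjoint_inner_right]
  have hbot := ContinuousLinearMap.orthogonalComplement_iSup_eigenspaces_eq_bot hAc hAs
  have hcl : ∀ μ : 𝕜, CompleteSpace (Module.End.eigenspace (A : X →ₗ[𝕜] X) μ) := by
    intro μ
    have : IsClosed (Module.End.eigenspace (A : X →ₗ[𝕜] X) μ : Set X) := by
      have h : (Module.End.eigenspace (A : X →ₗ[𝕜] X) μ : Set X) = {x | A x = μ • x} := by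
        ext x; simp
      rw [h]
      exact isClosed_eq A.continuous (continuous_const_smul μ)
    exact this.completeSpace_coe
  choose w e he using fun μ : 𝕜 =>
    exists_hilbertBasis 𝕜 (Module.End.eigenspace (A : X →ₗ[𝕜] X) μ)
  have hon : Orthonormal 𝕜 (fun a : Σ μ : 𝕜, w μ => ((e a.1 a.2 : _) : X)) :=
    hAs.orthogonalFamily_eigenspaces.orthonormal_sigma_orthonormal fun μ => (e μ).orthonormal
  have hsp : (Submodule.span 𝕜 (Set.range fun a : Σ μ : 𝕜, w μ => ((e a.1 a.2 : _) : X)))ᗮ = ⊥ := by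
    rw [eq_bot_iff, ← hbot]
    intro x hx
    rw [Submodule.mem_orthogonal] at hx ⊢
    -- A vector orthogonal to the chosen basis of every eigenspace is orthogonal to the eigenspaces
    -- themselves, hence zero by the spectral theorem.
    have key : (⨆ μ, Module.End.eigenspace (A : X →ₗ[𝕜] X) μ) ≤ (Submodule.span 𝕜 {x})ᗮ := by
      refine iSup_le fun μ y hy => ?_
      rw [Submodule.mem_orthogonal_singleton_iff_inner_right]
      have h1 := ((e μ).hasSum_repr ⟨y, hy⟩).mapL
        ((innerSL 𝕜 x).comp (Module.End.eigenspace (A : X →ₗ[𝕜] X) μ).subtypeL)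
      refine h1.unique ?_
      convert hasSum_zero using 2 with i
      have := hx (e μ i) (Submodule.subset_span ⟨⟨μ, i⟩, rfl⟩)
      simp [inner_eq_zero_symm.1 this]
    intro y hy
    have := key hy
    rw [Submodule.mem_orthogonal_singleton_iff_inner_right] at this
    exact inner_eq_zero_symm.1 this
  refine ⟨_, HilbertBasis.mkOfOrthogonalEqBot hon hsp, ?_⟩
  intro i j hij
  rw [HilbertBasis.coe_mkOfOrthogonalEqBot]
  have h1 : A (e i.1 i.2 : X) = i.1 • (e i.1 i.2 : X) := by
    simpa using Module.End.mem_eigenspace_iff.1 (e i.1 i.2).2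
  have h2 := hon.2 hij
  -- Moving `T` across turns the inner product of images into a multiple of that of two distinct
  -- orthonormal eigenvectors.
  rw [← ContinuousLinearMap.adjoint_inner_left]
  change inner 𝕜 (A (e i.1 i.2 : X)) (e j.1 j.2 : X) = 0
  rw [h1, inner_smul_left]
  simp [h2]

theorem approxNumber_bddBelow (n : ℕ) (T : X →L[𝕜] Y) :
    BddBelow {r : ℝ | ∃ A : X →L[𝕜] Y, A.toLinearMap.rank < n ∧ r = ‖T - A‖} :=
  ⟨0, by rintro _ ⟨A, -, rfl⟩; exact norm_nonneg _⟩

theorem approxNumber_nonneg (n : ℕ) (T : X →L[𝕜] Y) : 0 ≤ approxNumber n T :=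
  Real.sInf_nonneg (by rintro _ ⟨A, -, rfl⟩; exact norm_nonneg _)

theorem approxNumber_le (n : ℕ) (T A : X →L[𝕜] Y) (hA : A.toLinearMap.rank < n) :
    approxNumber n T ≤ ‖T - A‖ :=
  csInf_le (approxNumber_bddBelow n T) ⟨A, hA, rfl⟩

theorem approxNumber_anti {m n : ℕ} (hm : 0 < m) (hmn : m ≤ n) (T : X →L[𝕜] Y) :
    approxNumber n T ≤ approxNumber m T := by
  refine le_csInf ⟨_, 0, by simpa using hm, rfl⟩ ?_
  rintro _ ⟨A, hA, rfl⟩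
  exact approxNumber_le n T A (hA.trans_le (by exact_mod_cast hmn))

theorem approxNumber_le_norm {n : ℕ} (hn : 0 < n) (T : X →L[𝕜] Y) :
    approxNumber n T ≤ ‖T‖ := by
  simpa using approxNumber_le n T 0 (by simpa using hn)

/-- By a dimension count, an `A` of rank below `F.card` kills a nonzero vector in the span of `F`;
there `T - A` agrees with `T`, which is bounded below by `s`. -/
theorem OrthogonalImages.le_approxNumber {ι : Type*} {T : X →L[𝕜] Y} {b : ι → X}
    (hb : OrthogonalImages T b) (ho : Orthonormal 𝕜 b) {F : Finset ι} (hF0 : F.Nonempty) {s : ℝ}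
    (hs : 0 ≤ s) (hF : ∀ i ∈ F, s ≤ ‖T (b i)‖) : s ≤ approxNumber F.card T := by
  classical
  refine le_csInf ⟨_, 0, by simpa using hF0.card_pos, rfl⟩ ?_
  rintro _ ⟨A, hA, rfl⟩
  let g : (F → 𝕜) →ₗ[𝕜] X := Fintype.linearCombination 𝕜 fun i : F => b i
  have hg : ∀ c : F → 𝕜, g c = ∑ i ∈ F, (if h : i ∈ F then c ⟨i, h⟩ else 0) • b i := by
    intro c
    rw [← Finset.sum_coe_sort]
    simp [g, Fintype.linearCombination_apply]
  have hfin : FiniteDimensional 𝕜 (LinearMap.range A.toLinearMap) :=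
    Module.rank_lt_aleph0_iff.1 (hA.trans (Cardinal.natCast_lt_aleph0))
  have hker : LinearMap.ker (A.toLinearMap.rangeRestrict.comp g) ≠ ⊥ := by
    refine LinearMap.ker_ne_bot_of_finrank_lt ?_
    simpa using Module.finrank_lt_of_rank_lt hA
  obtain ⟨c, hc, hc0⟩ := Submodule.exists_mem_ne_zero_of_ne_bot hker
  have hx0 : g c ≠ 0 := by
    intro h
    apply hc0
    have := (ho.comp _ (Subtype.val_injective (p := (· ∈ F)))).linearIndependent
    exact funext (Fintype.linearIndependent_iff.1 this c h)
  have h1 : s * ‖g c‖ ≤ ‖T (g c)‖ := by rw [hg]; exact hb.le_norm_map_sum ho hs hF _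
  have h2 : A (g c) = 0 := congrArg Subtype.val (LinearMap.mem_ker.1 hc)
  have h3 : ‖T (g c)‖ ≤ ‖T - A‖ * ‖g c‖ := by
    simpa [h2] using (T - A).le_opNorm (g c)
  exact le_of_mul_le_mul_right (h1.trans h3) (norm_pos_iff.2 hx0)

/-- This replaces listing the singular values in decreasing order, as the index set of the basis
carries no order. -/
theorem OrthogonalImages.exists_le_approxNumber {ι : Type*} {T : X →L[𝕜] Y} {b : ι → X}
    (hb : OrthogonalImages T b) (ho : Orthonormal 𝕜 b) {F : Finset ι} (hF : F.Nonempty) :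
    ∃ i ∈ F, ‖T (b i)‖ ≤ approxNumber F.card T := by
  obtain ⟨i, hi, h⟩ := F.exists_min_image (fun i => ‖T (b i)‖) hF
  exact ⟨i, hi, hb.le_approxNumber ho hF (norm_nonneg _) h⟩

/-- The singular values are dominated by the approximation numbers. -/
theorem OrthogonalImages.sum_le_sum_approxNumber {ι : Type*} {T : X →L[𝕜] Y} {b : ι → X}
    (hb : OrthogonalImages T b) (ho : Orthonormal 𝕜 b) {q : ℝ} (hq : 0 ≤ q) (F : Finset ι) :
    ∑ i ∈ F, ‖T (b i)‖ ^ q ≤ ∑ n ∈ Finset.range F.card, approxNumber (n + 1) T ^ q := by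
  classical
  induction hn : F.card generalizing F with
  | zero => simp [Finset.card_eq_zero.1 hn]
  | succ n ih =>
    -- Peel off a vector whose image is controlled by the last approximation number; the rest is the
    -- induction hypothesis.
    obtain ⟨i, hi, h⟩ := hb.exists_le_approxNumber ho (F := F) (Finset.card_pos.1 (by omega))
    rw [← Finset.sum_erase_add _ _ hi, Finset.sum_range_succ]
    refine add_le_add (ih _ (by rw [Finset.card_erase_of_mem hi, hn]; rfl)) ?_
    rw [hn] at h
    exact Real.rpow_le_rpow (norm_nonneg _) h hq

/-- If all but one singular values are at most `s`, then `a_2 ≤ s`. -/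
theorem OrthogonalImages.approxNumber_two_le {ι : Type*} {T : X →L[𝕜] Y} {b : HilbertBasis ι 𝕜 X}
    (hb : OrthogonalImages T b) {s : ℝ} (hs : 0 ≤ s) (i₁ : ι)
    (h : ∀ i, i ≠ i₁ → ‖T (b i)‖ ≤ s) : approxNumber 2 T ≤ s := by
  let A : X →L[𝕜] Y := (innerSL 𝕜 (b i₁)).smulRight (T (b i₁))
  have hA : A.toLinearMap.rank < (2 : ℕ) := by
    have h1 : LinearMap.range A.toLinearMap ≤ Submodule.span 𝕜 {T (b i₁)} := by
      rintro _ ⟨x, rfl⟩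
      exact Submodule.smul_mem _ _ (Submodule.mem_span_singleton_self _)
    refine ((Submodule.rank_mono h1).trans (rank_span_le _)).trans_lt ?_
    simp
  refine (approxNumber_le 2 T A hA).trans ?_
  refine ContinuousLinearMap.opNorm_le_bound _ hs fun f => ?_
  have := hb.norm_map_sub_le (J := {i₁}) hs (by simpa using h) f
  simpa [A] using this

/-- The norm is attained at a basis element as soon as some approximation number is less. -/
theorem OrthogonalImages.exists_norm_eq {ι : Type*} {T : X →L[𝕜] Y} {b : HilbertBasis ι 𝕜 X}
    (hb : OrthogonalImages T b) {n : ℕ} (hn : 0 < n) (h : approxNumber n T < ‖T‖) :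
    ∃ i, ‖T (b i)‖ = ‖T‖ := by
  have hle : ∀ s, 0 ≤ s → (∀ i, ‖T (b i)‖ ≤ s) → ‖T‖ ≤ s := fun s hs H =>
    ContinuousLinearMap.opNorm_le_bound _ hs fun f => by
      simpa using hb.norm_map_sub_le (J := ∅) hs (fun i _ => H i) f
  -- Among any `n` basis vectors one has image norm at most `a_n`, so fewer than `n` exceed it. The
  -- supremum of the image norms is therefore a maximum over a finite set.
  have hfin : {i | approxNumber n T < ‖T (b i)‖}.Finite := by
    by_contra hinf
    obtain ⟨G, hG, hcard⟩ := Set.Infinite.exists_subset_card_eq hinf n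
    obtain ⟨i, hi, hi'⟩ := hb.exists_le_approxNumber b.orthonormal (F := G)
      (Finset.card_pos.1 (by omega))
    rw [hcard] at hi'
    exact absurd (hG hi) (not_lt.2 hi')
  have hne : {i | approxNumber n T < ‖T (b i)‖}.Nonempty := by
    by_contra hne
    rw [Set.not_nonempty_iff_eq_empty, Set.eq_empty_iff_forall_notMem] at hne
    exact absurd (hle _ (approxNumber_nonneg n T) fun i => not_lt.1 (hne i)) (not_le.2 h)
  obtain ⟨i, hi, hmax⟩ := Set.exists_max_image _ (fun i => ‖T (b i)‖) hfin hne
  refine ⟨i, le_antisymm ?_ (hle _ (norm_nonneg _) fun j => ?_)⟩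
  · simpa [b.orthonormal.1 i] using T.le_opNorm (b i)
  · by_cases hj : approxNumber n T < ‖T (b j)‖
    · exact hmax j hj
    · exact (not_lt.1 hj).trans (le_of_lt hi)

end SingularBasis

/-! ### Tensor powers of singular bases -/

section TensorBasis

variable {𝕜 : Type u} [RCLike 𝕜] {d : ℕ} {X : Type v} [NormedAddCommGroup X]
  [InnerProductSpace 𝕜 X] {Y : Type w} [NormedAddCommGroup Y] [InnerProductSpace 𝕜 Y]

theorem norm_pureTensor (f : Fin d → X) :
    ‖(pureTensor f : HilbertTensorPower 𝕜 d X)‖ = ∏ i, ‖f i‖ := by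
  have h := inner_pureTensor (𝕜 := 𝕜) f f
  simp only [inner_self_eq_norm_sq_to_K] at h
  have h2 : ‖(pureTensor f : HilbertTensorPower 𝕜 d X)‖ ^ 2 = (∏ i, ‖f i‖) ^ 2 := by
    rw [← Finset.prod_pow]
    exact_mod_cast h
  exact (pow_left_inj₀ (norm_nonneg _) (by positivity) two_ne_zero).1 h2

/-- The pure tensor as a continuous linear function of one of its factors. -/
def pureTensorUpdate (f : Fin d → X) (a : Fin d) : X →L[𝕜] HilbertTensorPower 𝕜 d X :=
  LinearMap.mkContinuous
    { toFun := fun x => pureTensor (Function.update f a x)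
      map_add' := fun x y => by
        simp only [pureTensor, algTprod_update_add, UniformSpace.Completion.coe_add]
      map_smul' := fun c x => by
        simp only [pureTensor, algTprod_update_smul, UniformSpace.Completion.coe_smul,
          RingHom.id_apply] }
    (∏ i ∈ Finset.univ.erase a, ‖f i‖) fun x => by
      change ‖pureTensor (Function.update f a x)‖ ≤ _
      rw [norm_pureTensor, ← Finset.prod_erase_mul _ _ (Finset.mem_univ a)]
      refine le_of_eq ?_
      rw [Function.update_self]
      congr 1
      refine Finset.prod_congr rfl fun i hi => ?_
      rw [Function.update_of_ne (Finset.ne_of_mem_erase hi)]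

theorem pureTensorUpdate_apply (f : Fin d → X) (a : Fin d) (x : X) :
    pureTensorUpdate (𝕜 := 𝕜) f a x = pureTensor (Function.update f a x) := rfl

theorem orthonormal_pureTensor {ι : Type*} {b : ι → X} (hb : Orthonormal 𝕜 b) :
    Orthonormal 𝕜 fun i : Fin d → ι =>
      (pureTensor fun j => b (i j) : HilbertTensorPower 𝕜 d X) := by
  refine ⟨fun i => by simp [norm_pureTensor, hb.1], fun i i' h => ?_⟩
  obtain ⟨j, hj⟩ := Function.ne_iff.1 h
  change inner 𝕜 (pureTensor _) (pureTensor _) = 0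
  rw [inner_pureTensor]
  exact Finset.prod_eq_zero (Finset.mem_univ j) (hb.2 hj)

/-- The set `s` holds the slots with arbitrary entries. Freeing one more slot works because the
entries allowed there form a closed subspace containing the basis. -/
theorem pureTensor_mem_closure_span {ι : Type*} (b : HilbertBasis ι 𝕜 X) (s : Finset (Fin d)) :
    ∀ f : Fin d → X, (∀ j ∉ s, f j ∈ Set.range b) →
      (pureTensor f : HilbertTensorPower 𝕜 d X) ∈ (Submodule.span 𝕜 (Set.range fun i : Fin d → ι =>
        (pureTensor fun j => b (i j) : HilbertTensorPower 𝕜 d X))).topologicalClosure := by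
  classical
  induction s using Finset.induction_on with
  | empty =>
    intro f hf
    choose i hi using fun j => hf j (Finset.notMem_empty j)
    refine Submodule.le_topologicalClosure _ (Submodule.subset_span ⟨i, ?_⟩)
    simp only [hi]
  | insert a s ha ih =>
    intro f hf
    set K := (Submodule.span 𝕜 (Set.range fun i : Fin d → ι =>
        (pureTensor fun j => b (i j) : HilbertTensorPower 𝕜 d X))).topologicalClosure with hK
    have hcl : IsClosed (K.comap (pureTensorUpdate (𝕜 := 𝕜) f a).toLinearMap : Set X) :=
      (Submodule.isClosed_topologicalClosure _).preimage (pureTensorUpdate (𝕜 := 𝕜) f a).continuous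
    have hsub : Submodule.span 𝕜 (Set.range b) ≤
        K.comap (pureTensorUpdate (𝕜 := 𝕜) f a).toLinearMap := by
      rw [Submodule.span_le]
      rintro _ ⟨i, rfl⟩
      change pureTensor (Function.update f a (b i)) ∈ K
      refine ih _ fun j hj => ?_
      by_cases hja : j = a
      · subst hja; simp
      · rw [Function.update_of_ne hja]
        exact hf j (by simp [hja, hj])
    have htop := Submodule.topologicalClosure_minimal _ hsub hcl
    rw [b.dense_span] at htop
    have := htop (Submodule.mem_top (x := f a))
    change pureTensor (Function.update f a (f a)) ∈ K at this
    rwa [Function.update_eq_self] at this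

/-- The tensor power of a Hilbert basis. -/
def tensorBasis (d : ℕ) {ι : Type*} (b : HilbertBasis ι 𝕜 X) :
    HilbertBasis (Fin d → ι) 𝕜 (HilbertTensorPower 𝕜 d X) :=
  HilbertBasis.mk (orthonormal_pureTensor b.orthonormal) (by
    have h : Submodule.span 𝕜 (Set.range (pureTensor (𝕜 := 𝕜) (d := d) (X := X))) ≤
        (Submodule.span 𝕜 (Set.range fun i : Fin d → ι =>
          (pureTensor fun j => b (i j) : HilbertTensorPower 𝕜 d X))).topologicalClosure := by
      rw [Submodule.span_le]
      rintro _ ⟨f, rfl⟩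
      exact pureTensor_mem_closure_span b Finset.univ f (by simp)
    have h2 := Submodule.topologicalClosure_minimal _ h
      (Submodule.isClosed_topologicalClosure _)
    rwa [Submodule.dense_iff_topologicalClosure_eq_top.1 dense_span_pureTensor] at h2)

theorem tensorBasis_apply {ι : Type*} (b : HilbertBasis ι 𝕜 X) (i : Fin d → ι) :
    tensorBasis d b i = pureTensor fun j => b (i j) := by
  simp [tensorBasis]

theorem OrthogonalImages.tensorPowerMap {ι : Type*} {T : X →L[𝕜] Y} {b : HilbertBasis ι 𝕜 X}
    (hb : OrthogonalImages T b) (d : ℕ) :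
    OrthogonalImages (tensorPowerMap d T) (tensorBasis d b) := by
  intro i i' h
  obtain ⟨j, hj⟩ := Function.ne_iff.1 h
  rw [tensorBasis_apply, tensorBasis_apply, tensorPowerMap_pureTensor, tensorPowerMap_pureTensor,
    inner_pureTensor]
  exact Finset.prod_eq_zero (Finset.mem_univ j) (hb hj)

theorem norm_tensorPowerMap_tensorBasis {ι : Type*} (T : X →L[𝕜] Y) (b : HilbertBasis ι 𝕜 X)
    (i : Fin d → ι) :
    ‖TensorTractability.tensorPowerMap d T (tensorBasis d b i)‖ = ∏ j, ‖T (b (i j))‖ := by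
  rw [tensorBasis_apply, tensorPowerMap_pureTensor, norm_pureTensor]

end TensorBasis

/-! ### Information complexity and counting singular values -/

section Complexity

variable {𝕜 : Type u} [RCLike 𝕜] {X : Type v} [NormedAddCommGroup X] [InnerProductSpace 𝕜 X]
  {Y : Type w} [NormedAddCommGroup Y] [InnerProductSpace 𝕜 Y]

theorem Algorithm.info_of_nonadaptive {Z : Type*} (L : ℕ → X →L[𝕜] 𝕜) (φ : List 𝕜 → Z) (f : X) (n : ℕ) :
    (Algorithm.mk (fun l => L l.length) φ).info f n = (List.range n).map fun k => L k f := by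
  induction n with
  | zero => rfl
  | succ n ih => simp [Algorithm.info, ih, List.range_succ]

theorem OrthogonalImages.minimalError_le {ι : Type*} {S : X →L[𝕜] Y} {b : HilbertBasis ι 𝕜 X}
    (hb : OrthogonalImages S b) {J : Finset ι} {s : ℝ} (hs : 0 ≤ s)
    (hJ : ∀ i ∉ J, ‖S (b i)‖ ≤ s) :
    minimalError 𝕜 (Metric.closedBall (0 : X) 1) S J.card ≤ ENNReal.ofReal s := by
  let e := J.equivFin.symm
  -- The algorithm reads off the coefficients along `J` and outputs the truncated expansion. The
  -- default zeros here and in `φ` are never reached during the `J.card` evaluations.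
  let L : ℕ → X →L[𝕜] 𝕜 := fun k => if h : k < J.card then innerSL 𝕜 (b (e ⟨k, h⟩)) else 0
  let φ : List 𝕜 → Y := fun l => ∑ k : Fin J.card, l.getD k 0 • S (b (e k))
  refine iInf_le_of_le (Algorithm.mk (fun l => L l.length) φ) (iSup₂_le fun f hf => ?_)
  have hrun : (Algorithm.mk (fun l => L l.length) φ).run J.card f =
      ∑ i ∈ J, (inner 𝕜 (b i) f : 𝕜) • S (b i) := by
    rw [Algorithm.run, Algorithm.info_of_nonadaptive, ← Finset.sum_coe_sort, ← e.sum_comp]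
    change ∑ k : Fin J.card, _ = _
    exact Finset.sum_congr rfl fun k _ => by simp [L]
  rw [hrun, ← ofReal_norm]
  refine ENNReal.ofReal_le_ofReal ((hb.norm_map_sub_le hs hJ f).trans ?_)
  exact mul_le_of_le_one_right hs (by simpa using hf)

/-- The functionals queried after all-zero histories do not depend on the input, so on their common
kernel adaptivity plays no role. -/
theorem Algorithm.info_eq_replicate {Z : Type*} (A : Algorithm 𝕜 X Z) (f : X) (n : ℕ)
    (h : ∀ k < n, A.functional (List.replicate k 0) f = 0) :
    A.info f n = List.replicate n 0 := by
  induction n with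
  | zero => rfl
  | succ n ih =>
    rw [Algorithm.info, ih fun k hk => h k (by omega), h n (by omega), List.replicate_succ']

/-- With fewer than `F.card` functionals, some unit vector `f` in the span of `F` gives only zero
information. Then `f` and `-f` receive the same output although their images are `2‖S f‖ ≥ 2s`
apart. -/
theorem OrthogonalImages.le_minimalError {ι : Type*} {S : X →L[𝕜] Y} {b : ι → X}
    (hb : OrthogonalImages S b) (ho : Orthonormal 𝕜 b) {F : Finset ι} {s : ℝ} (hs : 0 ≤ s)
    (hF : ∀ i ∈ F, s ≤ ‖S (b i)‖) {n : ℕ} (hn : n < F.card) :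
    ENNReal.ofReal s ≤ minimalError 𝕜 (Metric.closedBall (0 : X) 1) S n := by
  classical
  refine le_iInf fun A => ?_
  let g : (F → 𝕜) →ₗ[𝕜] X := Fintype.linearCombination 𝕜 fun i : F => b i
  have hg : ∀ c : F → 𝕜, g c = ∑ i ∈ F, (if h : i ∈ F then c ⟨i, h⟩ else 0) • b i := by
    intro c
    rw [← Finset.sum_coe_sort]
    simp [g, Fintype.linearCombination_apply]
  let N : X →ₗ[𝕜] (Fin n → 𝕜) :=
    LinearMap.pi fun k => (A.functional (List.replicate k 0)).toLinearMap
  have hker : LinearMap.ker (N.comp g) ≠ ⊥ := by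
    refine LinearMap.ker_ne_bot_of_finrank_lt ?_
    simpa using hn
  obtain ⟨c, hc, hc0⟩ := Submodule.exists_mem_ne_zero_of_ne_bot hker
  have hx0 : g c ≠ 0 := by
    intro h
    apply hc0
    have := (ho.comp _ (Subtype.val_injective (p := (· ∈ F)))).linearIndependent
    exact funext (Fintype.linearIndependent_iff.1 this c h)
  have hx : s * ‖g c‖ ≤ ‖S (g c)‖ := by rw [hg]; exact hb.le_norm_map_sum ho hs hF _
  have hN : ∀ k < n, A.functional (List.replicate k 0) (g c) = 0 := fun k hk =>
    congrFun (LinearMap.mem_ker.1 hc) ⟨k, hk⟩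
  have hpos : 0 < ‖g c‖ := norm_pos_iff.2 hx0
  set f : X := ((‖g c‖⁻¹ : ℝ) : 𝕜) • g c with hf
  have hf1 : ‖f‖ = 1 := by
    rw [hf, norm_smul]
    simp [hpos.ne']
  have hSf : s ≤ ‖S f‖ := by
    rw [hf, map_smul, norm_smul, RCLike.norm_ofReal, abs_of_pos (inv_pos.2 hpos), inv_mul_eq_div,
      le_div_iff₀ hpos]
    exact hx
  have hNf : ∀ k < n, A.functional (List.replicate k 0) f = 0 := fun k hk => by
    rw [hf, map_smul, hN k hk, smul_zero]
  have hrun : A.run n f = A.run n (-f) := by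
    rw [Algorithm.run, Algorithm.run, A.info_eq_replicate f n hNf,
      A.info_eq_replicate (-f) n fun k hk => by rw [map_neg, hNf k hk, neg_zero]]
  have hmax : s ≤ ‖S f - A.run n f‖ ∨ s ≤ ‖S (-f) - A.run n (-f)‖ := by
    by_contra! h
    have h1 := norm_sub_le (S f - A.run n f) (S (-f) - A.run n (-f))
    have h2 : S f - A.run n f - (S (-f) - A.run n (-f)) = (2 : 𝕜) • S f := by
      rw [hrun, map_neg, two_smul]; abel
    rw [h2, norm_smul, RCLike.norm_ofNat] at h1
    linarith [h.1, h.2]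
  rcases hmax with h | h
  · refine le_trans ?_ (le_iSup₂ (f := fun f (_ : f ∈ Metric.closedBall (0 : X) 1) =>
      ‖S f - A.run n f‖ₑ) f (by simp [hf1]))
    rw [← ofReal_norm]
    exact ENNReal.ofReal_le_ofReal h
  · refine le_trans ?_ (le_iSup₂ (f := fun f (_ : f ∈ Metric.closedBall (0 : X) 1) =>
      ‖S f - A.run n f‖ₑ) (-f) (by simp [hf1]))
    rw [← ofReal_norm]
    exact ENNReal.ofReal_le_ofReal h

theorem OrthogonalImages.card_le_informationComplexity {ι : Type*} {S : X →L[𝕜] Y} {b : ι → X}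
    (hb : OrthogonalImages S b) (ho : Orthonormal 𝕜 b) {F : Finset ι} {s : ℝ} (hs : 0 ≤ s)
    (hF : ∀ i ∈ F, s ≤ ‖S (b i)‖) :
    (F.card : ℕ∞) ≤ informationComplexity 𝕜 (Metric.closedBall (0 : X) 1) S s := by
  -- The complexity demands an error strictly below `s`, so the non-strict lower bound `s` already
  -- excludes `n`.
  refine le_iInf₂ fun n hn => ?_
  by_contra h
  exact absurd hn (not_lt.2 (hb.le_minimalError ho hs hF (by exact_mod_cast not_le.1 h)))

/-- Upper bound for the complexity of the tensor power in terms of a power sum of the singular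
values. -/
theorem OrthogonalImages.informationComplexity_tensorPowerMap_le {ι : Type*} {T : X →L[𝕜] Y}
    {b : HilbertBasis ι 𝕜 X} (hb : OrthogonalImages T b) (d : ℕ) {q M : ℝ} (hq : 0 ≤ q)
    (hM : ∀ F : Finset ι, ∑ i ∈ F, ‖T (b i)‖ ^ q ≤ M) {ε : ℝ} (hε : 0 < ε) :
    (informationComplexity 𝕜 (Metric.closedBall (0 : HilbertTensorPower 𝕜 d X) 1)
      (TensorTractability.tensorPowerMap d T) ε : ℝ≥0∞) ≤
        ENNReal.ofReal (M ^ d * (ε / 2) ^ (-q)) := by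
  classical
  -- Truncation at level `s` only gives an error `≤ s`; halving makes it strictly less than `ε`.
  set s := ε / 2 with hs
  have hs0 : 0 < s := by positivity
  let P : (Fin d → ι) → ℝ := fun i => ∏ j, ‖T (b (i j))‖
  have hcard : ∀ G : Finset (Fin d → ι), (∀ i ∈ G, s ≤ P i) → (G.card : ℝ) ≤ M ^ d * s ^ (-q) := by
    intro G hG
    -- `F` collects all indices occurring in `G`. Enlarging `G` to the full grid over `F` lets the
    -- power sum factor into a `d`th power.
    let F : Finset ι := G.biUnion fun i => Finset.univ.image i
    have hGF : G ⊆ Fintype.piFinset fun _ : Fin d => F := fun i hi =>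
      Fintype.mem_piFinset.2 fun j =>
        Finset.mem_biUnion.2 ⟨i, hi, Finset.mem_image_of_mem _ (Finset.mem_univ j)⟩
    have h1 : (G.card : ℝ) * s ^ q ≤ M ^ d := by
      calc (G.card : ℝ) * s ^ q = ∑ _i ∈ G, s ^ q := by simp
        _ ≤ ∑ i ∈ G, P i ^ q :=
          Finset.sum_le_sum fun i hi => Real.rpow_le_rpow hs0.le (hG i hi) hq
        _ ≤ ∑ i ∈ Fintype.piFinset fun _ : Fin d => F, P i ^ q :=
          Finset.sum_le_sum_of_subset_of_nonneg hGF fun i _ _ => by positivity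
        _ = ∑ i ∈ Fintype.piFinset fun _ : Fin d => F, ∏ j, ‖T (b (i j))‖ ^ q :=
          Finset.sum_congr rfl fun i _ =>
            (Real.finsetProd_rpow _ _ (fun j _ => norm_nonneg _) q).symm
        _ = (∑ i ∈ F, ‖T (b i)‖ ^ q) ^ d := by
          rw [← Finset.prod_univ_sum (fun _ : Fin d => F) fun _ i => ‖T (b i)‖ ^ q]
          simp
        _ ≤ M ^ d := by
          gcongr
          exact hM F
    rw [Real.rpow_neg hs0.le, ← div_eq_mul_inv, le_div_iff₀ (by positivity)]
    exact h1
  have hfin : {i | s ≤ P i}.Finite := by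
    by_contra hinf
    obtain ⟨G, hG, hn⟩ := Set.Infinite.exists_subset_card_eq hinf (⌊M ^ d * s ^ (-q)⌋₊ + 1)
    have h1 := hcard G fun i hi => hG hi
    have h2 := Nat.lt_floor_add_one (M ^ d * s ^ (-q))
    rw [hn] at h1
    push_cast at h1
    linarith
  have herr := (hb.tensorPowerMap d).minimalError_le (J := hfin.toFinset) hs0.le fun i hi => by
    rw [norm_tensorPowerMap_tensorBasis]
    exact (not_le.1 (by simpa using hi)).le
  have hlt := herr.trans_lt ((ENNReal.ofReal_lt_ofReal_iff hε).2 (half_lt_self hε))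
  calc (informationComplexity 𝕜 (Metric.closedBall (0 : HilbertTensorPower 𝕜 d X) 1)
      (TensorTractability.tensorPowerMap d T) ε : ℝ≥0∞)
      ≤ ((hfin.toFinset.card : ℕ∞) : ℝ≥0∞) := 
        ENat.toENNReal_mono (iInf_le_of_le hfin.toFinset.card (iInf_le _ hlt))
    _ = ENNReal.ofReal (hfin.toFinset.card : ℝ) := by simp
    _ ≤ _ := ENNReal.ofReal_le_ofReal (hcard _ fun i hi => by simpa using hi)

/-- Lower bound for the complexity of the tensor power in terms of two singular values. -/
theorem OrthogonalImages.choose_le_informationComplexity {ι : Type*} {T : X →L[𝕜] Y}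
    {b : HilbertBasis ι 𝕜 X} (hb : OrthogonalImages T b) (d k : ℕ) {i₁ i₂ : ι} (hne : i₂ ≠ i₁)
    (h₁ : ‖T (b i₁)‖ = 1) :
    (d.choose k : ℕ∞) ≤ informationComplexity 𝕜
      (Metric.closedBall (0 : HilbertTensorPower 𝕜 d X) 1)
      (TensorTractability.tensorPowerMap d T) (‖T (b i₂)‖ ^ k) := by
  classical
  -- Slots in `P` get the smaller singular value; the others contribute a factor 1, so `k`-element
  -- sets give exactly the threshold.
  let g : Finset (Fin d) → Fin d → ι := fun P j => if j ∈ P then i₂ else i₁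
  have hg : Function.Injective g := by
    intro P Q h
    ext j
    have := congrFun h j
    by_cases hP : j ∈ P <;> by_cases hQ : j ∈ Q <;> simp_all [g, eq_comm]
  have h := (hb.tensorPowerMap d).card_le_informationComplexity (tensorBasis d b).orthonormal
    (F := (Finset.powersetCard k Finset.univ).image g) (s := ‖T (b i₂)‖ ^ k) (by positivity)
    (by
      intro i hi
      obtain ⟨P, hP, rfl⟩ := Finset.mem_image.1 hi
      rw [norm_tensorPowerMap_tensorBasis]
      have h2 : ∀ j, ‖T (b (g P j))‖ = if j ∈ P then ‖T (b i₂)‖ else 1 := fun j => by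
        by_cases hj : j ∈ P <;> simp [g, hj, h₁]
      simp only [h2]
      rw [Finset.prod_ite_mem, Finset.univ_inter, Finset.prod_const,
        (Finset.mem_powersetCard.1 hP).2])
  rwa [Finset.card_image_of_injective _ hg, Finset.card_powersetCard, Finset.card_univ,
    Fintype.card_fin] at h

end Complexity

/-! ### Tractability and decay of the second approximation number -/

section Tractability

variable {𝕜 : Type u} [RCLike 𝕜]
  {X : ℕ+ → Type v} [∀ d, NormedAddCommGroup (X d)] [∀ d, InnerProductSpace 𝕜 (X d)]
  {Y : ℕ+ → Type w} [∀ d, NormedAddCommGroup (Y d)] [∀ d, InnerProductSpace 𝕜 (Y d)]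

theorem StronglyPolynomiallyTractable.polynomiallyTractable {S : ∀ d, X d →L[𝕜] Y d}
    (h : StronglyPolynomiallyTractable S) : PolynomiallyTractable S := by
  obtain ⟨C, q, hC, hq, h⟩ := h
  exact ⟨C, 0, q, hC, le_rfl, hq, h⟩

theorem DecaysPolynomially.exists_lt {a : ℕ+ → ℝ} (ha : DecaysPolynomially a) {ε : ℝ}
    (hε : 0 < ε) : ∃ n, a n < ε := by
  obtain ⟨C, s, hC, hs, h⟩ := ha
  have h1 : Filter.Tendsto (fun n : ℕ => C * (n : ℝ) ^ (-s)) Filter.atTop (nhds 0) := by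
    simpa using ((tendsto_rpow_neg_atTop hs).comp tendsto_natCast_atTop_atTop).const_mul C
  obtain ⟨n, hn, hn0⟩ := ((h1.eventually_lt_const hε).and (Filter.eventually_gt_atTop 0)).exists
  exact ⟨⟨n, hn0⟩, (h _).trans_lt hn⟩

/-- The elementary inequality behind the upper bound. -/
theorem sum_rpow_le_of_decay {a : ℕ → ℝ} {C s C' t q D : ℝ} (N : ℕ) (hC : 0 ≤ C) (hC' : 0 ≤ C')
    (ha : ∀ n, 0 ≤ a n) (h0 : a 0 ≤ 1) (hD : 1 ≤ D) (h1 : ∀ n, 1 ≤ n → a n ≤ C * D ^ (-s))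
    (h2 : ∀ n, a n ≤ C' * ((n + 1 : ℕ) : ℝ) ^ (-t)) (hq : 0 ≤ q) (hqs : 1 ≤ s * (q / 2))
    (hqt : 2 ≤ t * (q / 2)) :
    ∑ n ∈ Finset.range N, a n ^ q ≤
      1 + C ^ (q / 2) * C' ^ (q / 2) * (∑' n : ℕ, (((n + 1 : ℕ) : ℝ) ^ (2 : ℝ))⁻¹) / D := by
  have hD0 : 0 < D := by linarith
  set K := C ^ (q / 2) * C' ^ (q / 2) with hK
  have hK0 : 0 ≤ K := by positivity
  -- The term `n = 0` contributes at most 1. For `n ≥ 1` split `a n ^ q` into two halves: `h1` turns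
  -- one into a factor `1 / D`, and `h2` turns the other into a summable `(n + 1)^(-2)`.
  have hterm : ∀ n, a n ^ q ≤ (if n = 0 then 1 else 0) +
      K / D * (((n + 1 : ℕ) : ℝ) ^ (2 : ℝ))⁻¹ := by
    intro n
    rcases Nat.eq_zero_or_pos n with rfl | hn
    · have : a 0 ^ q ≤ 1 := Real.rpow_le_one (ha 0) h0 hq
      simp only [if_true]
      have : 0 ≤ K / D * (((0 + 1 : ℕ) : ℝ) ^ (2 : ℝ))⁻¹ := by positivity
      linarith
    · rw [if_neg hn.ne', zero_add]
      have hn1 : (1 : ℝ) ≤ ((n + 1 : ℕ) : ℝ) := by exact_mod_cast Nat.succ_pos n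
      have hq2 : 0 ≤ q / 2 := by positivity
      have e1 : a n ^ (q / 2) ≤ C ^ (q / 2) * D⁻¹ := by
        refine (Real.rpow_le_rpow (ha n) (h1 n hn) hq2).trans ?_
        rw [Real.mul_rpow hC (by positivity), ← Real.rpow_mul hD0.le, ← Real.rpow_neg_one D]
        refine mul_le_mul_of_nonneg_left ?_ (by positivity)
        exact Real.rpow_le_rpow_of_exponent_le hD (by linarith)
      have e2 : a n ^ (q / 2) ≤ C' ^ (q / 2) * (((n + 1 : ℕ) : ℝ) ^ (2 : ℝ))⁻¹ := by
        refine (Real.rpow_le_rpow (ha n) (h2 n) hq2).trans ?_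
        rw [Real.mul_rpow hC' (by positivity), ← Real.rpow_mul (by positivity),
          ← Real.rpow_neg (by positivity)]
        refine mul_le_mul_of_nonneg_left ?_ (by positivity)
        exact Real.rpow_le_rpow_of_exponent_le hn1 (by linarith)
      have e3 : a n ^ q = a n ^ (q / 2) * a n ^ (q / 2) := by
        rw [← Real.rpow_add_of_nonneg (ha n) hq2 hq2, add_halves]
      rw [e3]
      have := ha n
      refine (mul_le_mul e1 e2 (by positivity) (by positivity)).trans (le_of_eq ?_)
      rw [hK]; ring
  have hsum : Summable fun n : ℕ => (((n + 1 : ℕ) : ℝ) ^ (2 : ℝ))⁻¹ :=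
    (summable_nat_add_iff (f := fun n : ℕ => ((n : ℝ) ^ (2 : ℝ))⁻¹) 1).2
      (Real.summable_nat_rpow_inv.2 (by norm_num))
  calc ∑ n ∈ Finset.range N, a n ^ q
      ≤ ∑ n ∈ Finset.range N, ((if n = 0 then 1 else 0) +
          K / D * (((n + 1 : ℕ) : ℝ) ^ (2 : ℝ))⁻¹) := Finset.sum_le_sum fun n _ => hterm n
    _ = ∑ n ∈ Finset.range N, (if n = 0 then (1 : ℝ) else 0) +
          K / D * ∑ n ∈ Finset.range N, (((n + 1 : ℕ) : ℝ) ^ (2 : ℝ))⁻¹ := by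
        rw [Finset.sum_add_distrib, Finset.mul_sum]
    _ ≤ 1 + K / D * ∑' n : ℕ, (((n + 1 : ℕ) : ℝ) ^ (2 : ℝ))⁻¹ := by
        refine add_le_add ?_ (mul_le_mul_of_nonneg_left
          (hsum.sum_le_tsum _ fun n _ => by positivity) (by positivity))
        rw [Finset.sum_ite_eq']
        split_ifs <;> norm_num
    _ = _ := by ring

variable [∀ d, CompleteSpace (X d)] [∀ d, CompleteSpace (Y d)]

theorem stronglyPolynomiallyTractable_of_decaysPolynomially {T : ∀ d, X d →L[𝕜] Y d}
    (hcompact : ∀ d, IsCompactOperator (T d)) (hnorm : ∀ d, ‖T d‖ = 1)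
    (hanti : ∀ n : ℕ+, Antitone fun d : ℕ+ => approxNumber n (T d))
    (hdecay : DecaysPolynomially fun n : ℕ+ => approxNumber n (T 1))
    (h : DecaysPolynomially fun d : ℕ+ => approxNumber 2 (T d)) :
    StronglyPolynomiallyTractable (fun d : ℕ+ => tensorPowerMap (d : ℕ) (T d)) := by
  obtain ⟨C, s, hC, hs, h1⟩ := h
  obtain ⟨C', t, hC', ht, h2⟩ := hdecay
  -- The first summand secures `s q / 2 ≥ 1`, the second `t q / 2 ≥ 2`.
  set q : ℝ := 2 / s + 4 / t with hq
  have hq0 : 0 ≤ q := by positivity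
  have hqs : 1 ≤ s * (q / 2) := by
    have : s * (q / 2) = 1 + 2 * s / t := by rw [hq]; field_simp; ring
    rw [this]
    have : 0 ≤ 2 * s / t := by positivity
    linarith
  have hqt : 2 ≤ t * (q / 2) := by
    have : t * (q / 2) = t / s + 2 := by rw [hq]; field_simp; ring
    rw [this]
    have : 0 ≤ t / s := by positivity
    linarith
  set B := C ^ (q / 2) * C' ^ (q / 2) * (∑' n : ℕ, (((n + 1 : ℕ) : ℝ) ^ (2 : ℝ))⁻¹) with hB
  have hB0 : 0 ≤ B := mul_nonneg (by positivity) (tsum_nonneg fun n => by positivity)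
  refine ⟨Real.exp B * 2 ^ q, q, by positivity, hq0, fun d ε hε => ?_⟩
  obtain ⟨ι, b, hb⟩ := exists_hilbertBasis_orthogonalImages (hcompact d)
  have hd1 : (1 : ℝ) ≤ (d : ℕ) := by exact_mod_cast d.pos
  have hM : ∀ F : Finset ι, ∑ i ∈ F, ‖T d (b i)‖ ^ q ≤ 1 + B / (d : ℕ) := fun F => by
    refine (hb.sum_le_sum_approxNumber b.orthonormal hq0 F).trans ?_
    -- The index is shifted by one: `n = 0` is the norm, and `n ≥ 1` is dominated by `a_2`.
    -- Monotonicity in `d` transfers the decay in `n` from `T 1`.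
    refine sum_rpow_le_of_decay (a := fun n => approxNumber (n + 1) (T d)) (s := s) (t := t) _
      hC.le hC'.le (fun n => approxNumber_nonneg _ _) ?_ hd1 (fun n hn => ?_) (fun n => ?_)
      hq0 hqs hqt
    · exact (approxNumber_le_norm one_pos _).trans_eq (hnorm d)
    · exact (approxNumber_anti two_pos (by omega) _).trans (h1 d)
    · exact (hanti ⟨n + 1, n.succ_pos⟩ one_le).trans (h2 ⟨n + 1, n.succ_pos⟩)
  refine (hb.informationComplexity_tensorPowerMap_le d hq0 hM hε).trans
    (ENNReal.ofReal_le_ofReal ?_)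
  have hexp : (1 + B / (d : ℕ)) ^ (d : ℕ) ≤ Real.exp B := by
    calc (1 + B / (d : ℕ)) ^ (d : ℕ) ≤ Real.exp (B / (d : ℕ)) ^ (d : ℕ) := by
          gcongr
          rw [add_comm]
          exact Real.add_one_le_exp _
      _ = Real.exp B := by
          rw [← Real.exp_nat_mul, mul_div_cancel₀ _ (by positivity)]
  have hε2 : (ε / 2) ^ (-q) = 2 ^ q * ε ^ (-q) := by
    rw [Real.div_rpow hε.le two_pos.le, Real.rpow_neg two_pos.le, div_inv_eq_mul, mul_comm]
  rw [hε2, Real.rpow_zero, mul_one, mul_assoc]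
  gcongr

/-- The elementary inequality behind the lower bound. -/
theorem le_of_choose_le {d k : ℕ} {C p q σ : ℝ} (hC : 0 ≤ C) (hq : 0 < q)
    (hk : 0 < k) (hpk : p + 1 ≤ k) (hd : 2 * k ≤ d) (hσ : 0 < σ)
    (h : (d.choose k : ℝ) ≤ C * (σ ^ k) ^ (-q) * (d : ℝ) ^ p) :
    σ ≤ (2 ^ k * k.factorial * C) ^ (1 / (k * q)) * (d : ℝ) ^ (-(1 / (k * q))) := by
  have hkq : 0 < k * q := by positivity
  have hd1 : 1 ≤ d := by omega
  have hdR : (1 : ℝ) ≤ d := by exact_mod_cast hd1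
  -- Since `d ≥ 2k`, every factor of the descending factorial is at least `d / 2`.
  have h1 : ((d : ℝ) / 2) ^ k ≤ k.factorial * d.choose k := by
    have h2 := Nat.pow_sub_le_descFactorial d k
    rw [Nat.descFactorial_eq_factorial_mul_choose] at h2
    have h3 : (d : ℝ) / 2 ≤ ((d + 1 - k : ℕ) : ℝ) := by
      rw [Nat.cast_sub (by omega)]
      have : (2 : ℝ) * k ≤ d := by exact_mod_cast hd
      push_cast
      linarith
    refine (pow_le_pow_left₀ (by positivity) h3 k).trans ?_
    exact_mod_cast h2
  have hX : (σ ^ k) ^ (-q) = (σ ^ (k * q))⁻¹ := by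
    rw [Real.rpow_neg (by positivity), Real.rpow_mul hσ.le, Real.rpow_natCast]
  have h4 : σ ^ (k * q) ≤ 2 ^ k * k.factorial * C * (d : ℝ)⁻¹ := by
    have hpos : 0 < σ ^ (k * q) := by positivity
    have h5 : (d : ℝ) ^ k ≤ 2 ^ k * k.factorial * C * (σ ^ (k * q))⁻¹ * (d : ℝ) ^ p := by
      calc (d : ℝ) ^ k = 2 ^ k * ((d : ℝ) / 2) ^ k := by rw [div_pow]; field_simp
        _ ≤ 2 ^ k * (k.factorial * (C * (σ ^ k) ^ (-q) * (d : ℝ) ^ p)) := by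
          gcongr
          exact h1.trans (by gcongr)
        _ = _ := by rw [hX]; ring
    -- Here `p + 1 ≤ k` leaves one spare power of `d` after cancelling `d ^ p`.
    have h6 : (d : ℝ) * (d : ℝ) ^ p ≤ (d : ℝ) ^ k := by
      rw [mul_comm, ← Real.rpow_add_one (by positivity), ← Real.rpow_natCast]
      exact Real.rpow_le_rpow_of_exponent_le hdR hpk
    have h7 : (d : ℝ) ≤ 2 ^ k * k.factorial * C * (σ ^ (k * q))⁻¹ :=
      le_of_mul_le_mul_right (h6.trans h5) (by positivity)
    rw [← div_eq_mul_inv, le_div_iff₀ hpos] at h7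
    rw [← div_eq_mul_inv, le_div_iff₀ (by positivity), mul_comm]
    exact h7
  calc σ = (σ ^ (k * q)) ^ (1 / (k * q)) := by
        rw [← Real.rpow_mul hσ.le, mul_one_div_cancel hkq.ne', Real.rpow_one]
    _ ≤ (2 ^ k * k.factorial * C * (d : ℝ)⁻¹) ^ (1 / (k * q)) := by gcongr
    _ = _ := by
        rw [Real.mul_rpow (by positivity) (by positivity), Real.inv_rpow (by positivity),
          Real.rpow_neg (by positivity)]

theorem PolynomiallyTractable.decaysPolynomially {T : ∀ d, X d →L[𝕜] Y d}
    (hcompact : ∀ d, IsCompactOperator (T d)) (hnorm : ∀ d, ‖T d‖ = 1)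
    (hanti : ∀ n : ℕ+, Antitone fun d : ℕ+ => approxNumber n (T d))
    (hdecay : DecaysPolynomially fun n : ℕ+ => approxNumber n (T 1))
    (h : PolynomiallyTractable (fun d : ℕ+ => tensorPowerMap (d : ℕ) (T d))) :
    DecaysPolynomially fun d : ℕ+ => approxNumber 2 (T d) := by
  obtain ⟨C, p, q, hC, hp, hq, h⟩ := h
  -- By monotonicity `a_n(T d) < 1 = ‖T d‖` for every `d`, which makes the norm attained on the
  -- singular basis.
  obtain ⟨n, hn⟩ := hdecay.exists_lt one_pos
  set k := ⌈p⌉₊ + 1 with hk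
  have hk0 : 0 < k := Nat.succ_pos _
  have hpk : p + 1 ≤ k := by rw [hk]; push_cast; linarith [Nat.le_ceil p]
  -- The given `q` may be 0, but the final exponent divides by it; enlarging it is harmless because
  -- `σ ^ k ≤ 1`.
  set Q := q + 1 with hQ
  have hQ0 : 0 < Q := by positivity
  set r := 1 / (k * Q) with hr
  have hr0 : 0 < r := by positivity
  set D : ℝ := 2 ^ k * k.factorial * C with hD
  -- The first summand serves `d ≥ 2k`, with the 2 coming from `σ > a_2 / 2`; the second covers `d <
  -- 2k` through `a_2 ≤ 1` and keeps the constant positive when `C = 0`.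
  refine ⟨2 * D ^ r + (2 * k) ^ r, r, by positivity, hr0, fun d => ?_⟩
  have hd0 : (0 : ℝ) < d := by exact_mod_cast d.pos
  rw [add_mul]
  rcases lt_or_ge (d : ℕ) (2 * k) with hd | hd
  · have h1 : approxNumber 2 (T d) ≤ 1 := (approxNumber_le_norm two_pos _).trans_eq (hnorm d)
    have h2 : 1 ≤ (2 * k : ℝ) ^ r * (d : ℝ) ^ (-r) := by
      rw [Real.rpow_neg hd0.le, ← div_eq_mul_inv, ← Real.div_rpow (by positivity) hd0.le]
      refine Real.one_le_rpow ?_ hr0.le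
      rw [one_le_div hd0]
      exact_mod_cast hd.le
    have h3 : 0 ≤ 2 * D ^ r * (d : ℝ) ^ (-r) := by positivity
    exact h1.trans (by linarith)
  · have h3 : 0 ≤ (2 * k : ℝ) ^ r * (d : ℝ) ^ (-r) := by positivity
    suffices approxNumber 2 (T d) ≤ 2 * D ^ r * (d : ℝ) ^ (-r) by linarith
    rcases (approxNumber_nonneg 2 (T d)).eq_or_lt with ha | ha
    · rw [← ha]; positivity
    obtain ⟨ι, b, hb⟩ := exists_hilbertBasis_orthogonalImages (hcompact d)
    have hnd : approxNumber n (T d) < ‖T d‖ := by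
      rw [hnorm]
      exact (hanti n one_le).trans_lt hn
    obtain ⟨i₁, h₁⟩ := hb.exists_norm_eq n.pos hnd
    rw [hnorm] at h₁
    -- Otherwise a rank-one truncation at `i₁` would give `a_2 ≤ a_2 / 2`, contradicting `a_2 > 0`.
    obtain ⟨i₂, hne, h₂⟩ : ∃ i₂, i₂ ≠ i₁ ∧ approxNumber 2 (T d) / 2 < ‖T d (b i₂)‖ := by
      by_contra! hcon
      have := hb.approxNumber_two_le (half_pos ha).le i₁ hcon
      linarith
    set σ := ‖T d (b i₂)‖ with hσ
    have hσ0 : 0 < σ := (half_pos ha).trans h₂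
    have hσ1 : σ ≤ 1 := by
      simpa [b.orthonormal.1 i₂, hnorm] using (T d).le_opNorm (b i₂)
    have hcx := (ENat.toENNReal_mono
      (hb.choose_le_informationComplexity (d : ℕ) k hne h₁)).trans (h d (σ ^ k) (by positivity))
    have hch : ((d : ℕ).choose k : ℝ) ≤ C * (σ ^ k) ^ (-q) * (d : ℝ) ^ p := by
      rw [ENat.toENNReal_coe, ← ENNReal.ofReal_natCast] at hcx
      exact (ENNReal.ofReal_le_ofReal_iff (by positivity)).1 hcx
    have hch' : ((d : ℕ).choose k : ℝ) ≤ C * (σ ^ k) ^ (-Q) * ((d : ℕ) : ℝ) ^ p := by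
      refine hch.trans ?_
      gcongr ?_ * ?_ * _
      exact Real.rpow_le_rpow_of_exponent_ge (by positivity) (pow_le_one₀ hσ0.le hσ1)
        (by linarith)
    have := le_of_choose_le hC hQ0 hk0 hpk hd hσ0 hch'
    rw [mul_assoc]
    linarith

end Tractability

end TensorTractability

end

open TensorTractability
theorem mainTheorem3 {𝕜 : Type*} [RCLike 𝕜]
    {X : ℕ+ → Type*} [∀ d, NormedAddCommGroup (X d)] [∀ d, InnerProductSpace 𝕜 (X d)]
    [∀ d, CompleteSpace (X d)]
    {Y : ℕ+ → Type*} [∀ d, NormedAddCommGroup (Y d)] [∀ d, InnerProductSpace 𝕜 (Y d)]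
    [∀ d, CompleteSpace (Y d)]
    (T : ∀ d, X d →L[𝕜] Y d)
    (hcompact : ∀ d, IsCompactOperator (T d))
    (hnorm : ∀ d, ‖T d‖ = 1)
    (hanti : ∀ n : ℕ+, Antitone fun d : ℕ+ => approxNumber n (T d))
    (hdecay : DecaysPolynomially fun n : ℕ+ => approxNumber n (T 1)) :
    (StronglyPolynomiallyTractable (fun d : ℕ+ => tensorPowerMap (d : ℕ) (T d)) ↔
      PolynomiallyTractable (fun d : ℕ+ => tensorPowerMap (d : ℕ) (T d))) ∧
    (PolynomiallyTractable (fun d : ℕ+ => tensorPowerMap (d : ℕ) (T d)) ↔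
      DecaysPolynomially fun d : ℕ+ => approxNumber 2 (T d)) := by
  have h1 := PolynomiallyTractable.decaysPolynomially hcompact hnorm hanti hdecay
  have h2 := stronglyPolynomiallyTractable_of_decaysPolynomially hcompact hnorm hanti hdecay
  exact ⟨⟨fun h => h.polynomiallyTractable, fun h => h2 (h1 h)⟩,
    ⟨h1, fun h => (h2 h).polynomiallyTractable⟩⟩
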